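/- **Theorem.** Write $\binom{[n]}{r}$ for the family of all $r$-subsets of $[n]=\{1,\dots,n\}$. Order $\binom{[n]}{r}$ by the squashed order: $A<_sB$ if $A\ne B$ and the largest element of the symmetric difference of $A$ and $B$ lies in $B$. Let $F_{n,r}(m)$ and $L_{n,r}(m)$ be the families of the first $m$ and the last $m$ $r$-subsets of $[n]$ in this order. For a family $\mathscr F\subseteq\binom{[n]}{r}$ let $\Delta\mathscr F$ be its shadow (the $(r-1)$-sets contained in a member of $\mathscr F$) and $\nabla\mathscr F$ its shade (the $(r+1)$-subsets of $[n]$ containing a member of $\mathscr F$). For $0\le i\le\binom nr$ put $$\kappa_{n,r}(i)=|\Delta F_{n,r}(i)|-i,\qquad \kappa^*_{n,r}(i)=\min_{0\le j\le i}\kappa_{n,r}(j).$$ Let $n\ge 4$ be even, write $\kappa_{n/2}=\kappa_{n,n/2}$, $\kappa^*_{n/2}=\kappa^*_{n,n/2}$ and $t=1+\sum_{i=1}^{n/2}\binom{2i-1}{i}$, and let $k\ge 0$ be an integer. Call a pair $(\mathscr A,\mathscr B)$ of families of subsets of $[n]$ *admissible for $k$* if $\mathscr A$ and $\mathscr B$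 are antichains with respect to inclusion, $k\le\min\{|\mathscr A|,|\mathscr B|\}$, and there are at most $k$ disjoint pairs, in the sense that the members can be enumerated as $\mathscr A=\{A_1,A_2,\dots\}$, $\mathscr B=\{B_1,B_2,\dots\}$ (without repetition) so that $A_i\cap B_j=\emptyset$ only if $i=j\le k$. (a) If $(\mathscr A,\mathscr B)$ is admissible for $k$, then $$|\mathscr A|+|\mathscr B|\le\binom{n}{n/2}+\binom{n}{n/2+1}-\kappa^*_{n/2}(k).$$ The same bound holds if the enumeration condition is replaced by the condition that at most $k$ pairs $(A,B)\in\mathscr A\times\mathscr B$ satisfy $A\cap B=\emptyset$. (b) For $k\le\binom n{n/2}$, $\kappa^*_{n/2}(k)=0$ if $k<t$, and $\kappa^*_{n/2}(k)<0$ if $k\ge t$. (c) If $k<t$, then $\mathscr A=\binom{[n]}{n/2}$, $\mathscr B=\binom{[n]}{n/2+1}$ is admissible for $k$ and attains equality in (a). (d) If $t\le k\le\binom n{n/2}$, then there is an integer $0\le m\le k$ with $\kappa_{n/2}(m)=\kappa^*_{n/2}(k)$, and for every such $m$ the pair $\mathscr A=\binom{[n]}{n/2}$, $\mathscr B=L_{n,n/2}(m)\cup\Big(\binom{[n]}{n/2+1}\setminus\nabla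 L_{n,n/2}(m)\Big)$ is admissible for $k$ and attains equality in (a). -/

import Mathlib

open Finset

open scoped FinsetFamily

namespace DisjointPairs

/-- The family of all `r`-element subsets of the ground set `Fin n`. -/
abbrev level (n r : ℕ) : Finset (Finset (Fin n)) :=
  powersetCard r univ

/-- The first `m` of the `r`-subsets of `Fin n` in squashed order: those with fewer than `m`
predecessors. The squashed order (`A < B` if the largest element of the symmetric difference of
`A` and `B` is in `B`) is Mathlib's colexicographic order. -/
def firstSets (n r m : ℕ) : Finset (Finset (Fin n)) :=
  {S ∈ level n r | #{T ∈ level n r | toColex T < toColex S} < m}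

/-- The last `m` of the `r`-subsets of `Fin n` in squashed order: those with fewer than `m`
successors. -/
def lastSets (n r m : ℕ) : Finset (Finset (Fin n)) :=
  {S ∈ level n r | #{T ∈ level n r | toColex S < toColex T} < m}

/-- The Kruskal-Katona function: `|Δ F_{n,r}(i)| - i`. -/
def kappa (n r i : ℕ) : ℤ :=
  (#(∂ (firstSets n r i)) : ℤ) - (i : ℤ)

/-- The minimum of `kappa n r j` over `0 ≤ j ≤ i`. -/
def kappaStar (n r i : ℕ) : ℤ :=
  (range (i + 1)).inf' nonempty_range_add_one (kappa n r)

/-- The number `1 + ∑_{i=1}^{r} C(2i-1, i)`. -/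
def threshold (r : ℕ) : ℕ :=
  1 + ∑ i ∈ Icc 1 r, (2 * i - 1).choose i

/-- `A` and `B` have at most `k` disjoint pairs: their members can be enumerated as
`A_1, A_2, …` and `B_1, B_2, …` such that `A_i ∩ B_j = ∅` only if `i = j ≤ k`. The enumerations
here start at `0`, so that `i ≤ k` becomes `i < k`. -/
def AtMostDisjointPairs {n : ℕ} (k : ℕ) (A B : Finset (Finset (Fin n))) : Prop :=
  ∃ (a : Fin (#A) ≃ A) (b : Fin (#B) ≃ B), ∀ (i : Fin (#A)) (j : Fin (#B)),
    (a i : Finset (Fin n)) ∩ (b j : Finset (Fin n)) = ∅ → (i : ℕ) = (j : ℕ) ∧ (i : ℕ) < k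

/-- The pairs under consideration: two antichains, each with at least `k` members, having at most
`k` disjoint pairs. -/
structure Admissible {n : ℕ} (k : ℕ) (A B : Finset (Finset (Fin n))) : Prop where
  antichain_left : IsAntichain (· ⊆ ·) (A : Set (Finset (Fin n)))
  antichain_right : IsAntichain (· ⊆ ·) (B : Set (Finset (Fin n)))
  le_card : k ≤ min (#A) (#B)
  disjoint_pairs : AtMostDisjointPairs k A B

end DisjointPairs

/-! Put n = 2h+2 and N = C(n,h+1), and replace B by the family C of complements of its members.
Disjointness becomes inclusion, and A ∩ C records the complementary pairs; all that the bound uses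
is that A and C are antichains with |A ∩ C| ≤ k.

Since A ∪ C has no chain of three members, it can be redistributed into its maximal members and the
rest, with A ∩ C kept in both, so that no set of the first family lies properly inside one of the
second. Pushing the first family up and the second down to level h+1 gives families X, Y meeting in
at most k sets, so |X| + |Y| ≤ N + k. A local LYM argument bounds |A| + |C| by |X| + |Y| + 2C(n,h)
minus the shade of X and the shadow of Y (`card_add_card_shadow_falling_le`).

By Kruskal-Katona it remains to prove an inequality for the minimal shadow function S on level h+1
(`choose_add_kappaStar_le`). If |X| or |Y| is below the threshold, where S(i) ≥ i, Sperner's theorem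
suffices. Otherwise |X| + |Y| = N + d with 0 ≤ d ≤ k, and S(N) + S(d) ≤ S(|X|) + S(|Y|), because the
final increments of S are its smallest. This last fact is proved by induction (`shadowSize_joint`):
colex order lists the sets avoiding the largest element first, so S is a concatenation of two
smaller shadow functions. -/

namespace DisjointPairs

/-! ### Increments of concatenated functions -/

/-- Among the increments of `F : {0, …, N} → ℕ` over intervals of a given length, the one over the
last interval is smallest. -/
def TailMinimal (N : ℕ) (F : ℕ → ℕ) : Prop :=
  ∀ a c d, a ≤ N → c ≤ N → a + c = N + d → F N + F d ≤ F a + F c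

/-- `F : {0, …, N} → ℕ` is subadditive. -/
def SubadditiveUpTo (N : ℕ) (F : ℕ → ℕ) : Prop :=
  ∀ u v, u + v ≤ N → F (u + v) ≤ F u + F v

/-- The final increments of `F` on `{0, …, M}` are at least those of `G` on `{0, …, N}`. -/
def TailDominates (M : ℕ) (F : ℕ → ℕ) (N : ℕ) (G : ℕ → ℕ) : Prop :=
  ∀ x i j, i + x = M → j + x = N → G N + F i ≤ F M + G j

/-- `G ≤ F` wherever both are defined. -/
def Dominates (M : ℕ) (F : ℕ → ℕ) (N : ℕ) (G : ℕ → ℕ) : Prop :=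
  ∀ v, v ≤ M → v ≤ N → G v ≤ F v

/-- Continue `f` after `z` with the increments of `g`. -/
def glue (z : ℕ) (f g : ℕ → ℕ) (i : ℕ) : ℕ :=
  if i ≤ z then f i else f z + g (i - z)

section Glue

variable {z y w : ℕ} {f g e : ℕ → ℕ}

theorem glue_of_le {i : ℕ} (h : i ≤ z) : glue z f g i = f i := if_pos h

theorem glue_add (g0 : g 0 = 0) (j : ℕ) : glue z f g (z + j) = f z + g j := by
  unfold glue
  split_ifs with h
  · obtain rfl : j = 0 := by omega
    simp [g0]
  · simp

/-- A window inside one piece is compared by minimality in that piece; `Q` lets the end of `f`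
absorb increments of `g`, and subadditivity of `g` covers a window that reaches back across the
joint. -/
theorem tailMinimal_glue (g0 : g 0 = 0) (Pf : TailMinimal z f) (Pg : TailMinimal y g)
    (Sg : SubadditiveUpTo y g) (Q : TailDominates z f y g) :
    TailMinimal (z + y) (glue z f g) := by
  suffices H : ∀ a c d, a ≤ z + y → c ≤ a → a + c = z + y + d →
      glue z f g (z + y) + glue z f g d ≤ glue z f g a + glue z f g c by
    intro a c d ha hc h
    rcases le_total c a with hca | hca
    · exact H a c d ha hca h
    · have := H c a d hc hca (by omega)
      omega
  intro a c d ha hca h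
  rw [glue_add g0]
  rcases le_total z a with hza | hza
  · obtain ⟨a', rfl⟩ := Nat.exists_eq_add_of_le hza
    rw [glue_add g0]
    rcases le_total z c with hzc | hzc
    · obtain ⟨c', rfl⟩ := Nat.exists_eq_add_of_le hzc
      rw [glue_add g0]
      rcases le_total z d with hzd | hzd
      · obtain ⟨d', rfl⟩ := Nat.exists_eq_add_of_le hzd
        rw [glue_add g0]
        have := Pg a' c' d' (by omega) (by omega) (by omega)
        omega
      · rw [glue_of_le hzd]
        have h1 := Q (z - d) d (a' + c') (by omega) (by omega)
        have h2 := Sg a' c' (by omega)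
        omega
    · rw [glue_of_le hzc, glue_of_le (show d ≤ z by omega)]
      have h1 := Pf (z - (y - a')) c d (by omega) hzc (by omega)
      have h2 := Q (y - a') (z - (y - a')) a' (by omega) (by omega)
      omega
  · rw [glue_of_le hza, glue_of_le (show c ≤ z by omega), glue_of_le (show d ≤ z by omega)]
    -- Here all arguments lie in `f`. The last window of `f` of length `y` separates the two sides:
    -- it is at most the increment from `d` to `d + y`, and by `Q` at least all of `g`.
    have h1 := Pf a c (d + y) hza (by omega) (by omega)
    have h2 := Pf (z - y) (d + y) d (by omega) (by omega) (by omega)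
    have h3 := Q y (z - y) 0 (by omega) (by omega)
    omega

theorem subadditiveUpTo_glue (g0 : g 0 = 0) (Pf : TailMinimal z f) (Sf : SubadditiveUpTo z f)
    (Sg : SubadditiveUpTo y g) (M : Dominates z f y g) :
    SubadditiveUpTo (z + y) (glue z f g) := by
  suffices H : ∀ u v, v ≤ u → u + v ≤ z + y →
      glue z f g (u + v) ≤ glue z f g u + glue z f g v by
    intro u v h
    rcases le_total v u with hvu | hvu
    · exact H u v hvu h
    · have := H v u hvu (by omega)
      rw [add_comm v u] at this
      omega
  intro u v hvu h
  rcases le_total z u with hzu | hzu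
  · obtain ⟨u', rfl⟩ := Nat.exists_eq_add_of_le hzu
    rw [add_assoc, glue_add g0, glue_add g0]
    have h1 := Sg u' v (by omega)
    rcases le_total z v with hzv | hzv
    · obtain ⟨v', rfl⟩ := Nat.exists_eq_add_of_le hzv
      rw [glue_add g0]
      have h2 := Sg z v' (by omega)
      have h3 := M z le_rfl (by omega)
      omega
    · rw [glue_of_le hzv]
      have h2 := M v hzv (by omega)
      omega
  · rw [glue_of_le hzu, glue_of_le (show v ≤ z by omega)]
    rcases le_total (u + v) z with hz | hz
    · rw [glue_of_le hz]
      exact Sf u v hz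
    · obtain ⟨j, hj⟩ := Nat.exists_eq_add_of_le hz
      rw [hj, glue_add g0]
      have h1 := Pf u v j hzu (by omega) (by omega)
      have h2 := M j (by omega) (by omega)
      omega

/-- The two concatenations share `g`, as last piece of one and first piece of the other, so
comparisons pass through `g`. Hypothesis `hu` expresses unimodality of the three lengths `z`, `y`,
`w`, which are consecutive binomial coefficients in the application. -/
theorem tailDominates_glue (g0 : g 0 = 0) (e0 : e 0 = 0) (Pf : TailMinimal z f)
    (Pg : TailMinimal y g) (Sg : SubadditiveUpTo y g) (Se : SubadditiveUpTo w e)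
    (Qfg : TailDominates z f y g) (Qge : TailDominates y g w e) (Mge : Dominates y g w e)
    (hu : y < w → z ≤ y) :
    TailDominates (z + y) (glue z f g) (y + w) (glue y g e) := by
  intro x i j hi hj
  rw [glue_add g0, glue_add e0]
  rcases le_or_gt x y with hxy | hxy
  · obtain rfl : i = z + (y - x) := by omega
    rw [glue_add g0]
    rcases le_or_gt x w with hxw | hxw
    · obtain rfl : j = y + (w - x) := by omega
      rw [glue_add e0]
      have := Qge x (y - x) (w - x) (by omega) (by omega)
      omega
    · rw [glue_of_le (show j ≤ y by omega)]
      have h1 := Pg (y - w) j (y - x) (by omega) (by omega) (by omega)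
      have h2 := Qge w (y - w) 0 (by omega) (by omega)
      omega
  · rw [glue_of_le (show i ≤ z by omega)]
    rcases le_or_gt x w with hxw | hxw
    · obtain rfl : j = y + (w - x) := by omega
      rw [glue_add e0]
      have := hu (by omega)
      have h1 := Qfg (x - y) i (y - (x - y)) (by omega) (by omega)
      have h2 := Qge (x - y) (y - (x - y)) (w - x + y) (by omega) (by omega)
      have h3 := Se (w - x) y (by omega)
      have h4 := Mge y le_rfl (by omega)
      omega
    · rw [glue_of_le (show j ≤ y by omega)]
      rcases le_or_gt w y with hwy | hwy
      · have h1 := Qfg (x - y) i (y - (x - y)) (by omega) (by omega)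
        have h2 := Sg (y - w) (w - (x - y)) (by omega)
        rw [show y - w + (w - (x - y)) = y - (x - y) by omega,
          show w - (x - y) = j by omega] at h2
        have h3 := Qge w (y - w) 0 (by omega) (by omega)
        omega
      · have := hu hwy
        have h1 := Pf (z - (w - y)) (z - (x - w)) i (by omega) (by omega) (by omega)
        have h2 := Qfg (x - w) (z - (x - w)) j (by omega) (by omega)
        have h3 := Qfg (w - y) (z - (w - y)) (y - (w - y)) (by omega) (by omega)
        have h4 := Qge (w - y) (y - (w - y)) y (by omega) (by omega)
        have h5 := Mge y le_rfl (by omega)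
        omega

theorem dominates_glue (g0 : g 0 = 0) (e0 : e 0 = 0) (Pf : TailMinimal z f)
    (Pg : TailMinimal y g) (Sg : SubadditiveUpTo y g)
    (Qfg : TailDominates z f y g) (Mfg : Dominates z f y g) (Mge : Dominates y g w e)
    (hu : y < z → w ≤ y) :
    Dominates (z + y) (glue z f g) (y + w) (glue y g e) := by
  intro v hv hv'
  rcases le_or_gt v y with hvy | hvy
  · rw [glue_of_le hvy]
    rcases le_or_gt v z with hvz | hvz
    · rw [glue_of_le hvz]
      exact Mfg v hvz hvy
    · obtain ⟨j, rfl⟩ := Nat.exists_eq_add_of_le hvz.le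
      rw [glue_add g0]
      have h1 := Mfg z le_rfl (by omega)
      have h2 := Sg z j hvy
      omega
  · obtain ⟨j, rfl⟩ := Nat.exists_eq_add_of_le hvy.le
    rw [glue_add e0]
    rcases le_or_gt (y + j) z with hvz | hvz
    · rw [glue_of_le hvz]
      have := hu (by omega)
      have h1 := Pf (z - y) (y + j) j (by omega) hvz (by omega)
      have h2 := Qfg y (z - y) 0 (by omega) (by omega)
      have h3 := Mfg j (by omega) (by omega)
      have h4 := Mge j (by omega) (by omega)
      omega
    · obtain ⟨l, hl⟩ := Nat.exists_eq_add_of_le hvz.le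
      rw [hl, glue_add g0]
      rcases le_or_gt z y with hzy | hzy
      · have h1 := Mfg z le_rfl hzy
        have h2 := Pg z l j hzy (by omega) (by omega)
        have h3 := Mge j (by omega) (by omega)
        omega
      · have := hu hzy
        have h1 := Qfg y (z - y) 0 (by omega) (by omega)
        have h2 := Mfg (z - y) (by omega) (by omega)
        have h3 := Sg (z - y) l (by omega)
        rw [show z - y + l = j by omega] at h3
        have h4 := Mge j (by omega) (by omega)
        omega

end Glue

/-! ### The shadow function and its inequalities -/

/-- The size of the shadow of the first `i` of the `p`-subsets of a set of size `p + q`. -/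
def shadowSize : ℕ → ℕ → ℕ → ℕ
  | 0, _, _ => 0
  | p + 1, 0, i => i * (p + 1)
  | p + 1, q + 1, i =>
    if i ≤ (p + 1 + q).choose (p + 1) then shadowSize (p + 1) q i
    else shadowSize (p + 1) q ((p + 1 + q).choose (p + 1))
      + shadowSize p (q + 1) (i - (p + 1 + q).choose (p + 1))
termination_by p q => (p, q)

theorem shadowSize_zero_left (q i : ℕ) : shadowSize 0 q i = 0 := by simp [shadowSize]

theorem shadowSize_zero_mid (p i : ℕ) : shadowSize p 0 i = i * p := by
  cases p <;> simp [shadowSize]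

theorem shadowSize_succ_succ (p q : ℕ) :
    shadowSize (p + 1) (q + 1) =
      glue ((p + 1 + q).choose (p + 1)) (shadowSize (p + 1) q) (shadowSize p (q + 1)) := by
  funext i
  rw [shadowSize, glue]

theorem choose_split (p q : ℕ) : (p + 1 + (q + 1)).choose (p + 1) =
    (p + 1 + q).choose (p + 1) + (p + (q + 1)).choose p := by
  rw [show p + 1 + (q + 1) = p + 1 + q + 1 by omega, Nat.choose_succ_succ', add_comm,
    show p + 1 + q = p + (q + 1) by omega]

theorem shadowSize_zero_right (p q : ℕ) : shadowSize p q 0 = 0 := by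
  induction q with
  | zero => simp [shadowSize_zero_mid]
  | succ q ih =>
    cases p with
    | zero => simp [shadowSize_zero_left]
    | succ p => rw [shadowSize_succ_succ, glue_of_le (Nat.zero_le _), ih]

theorem shadowSize_one (p q : ℕ) : shadowSize p q 1 = p := by
  induction q with
  | zero => simp [shadowSize_zero_mid]
  | succ q ih =>
    cases p with
    | zero => simp [shadowSize_zero_left]
    | succ p => rw [shadowSize_succ_succ, glue_of_le (Nat.choose_pos (by omega)), ih]

theorem shadowSize_mono (p q : ℕ) : Monotone (shadowSize p q) := by
  induction p generalizing q with
  | zero => intro a b _; simp [shadowSize_zero_left]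
  | succ p ihp =>
    induction q with
    | zero => intro a b h; simp only [shadowSize_zero_mid]; gcongr
    | succ q ihq =>
      intro a b h
      rw [shadowSize_succ_succ]
      unfold glue
      split_ifs with h1 h2 h2
      · exact ihq h
      · exact (ihq h1).trans (Nat.le_add_right _ _)
      · omega
      · exact Nat.add_le_add_left (ihp _ (by omega)) _

/-- Unimodality of a binomial row: once it strictly decreases, it never increases again. -/
theorem choose_succ_lt_of_lt {n k : ℕ} (h : n.choose (k + 1) < n.choose k) :
    n.choose (k + 2) ≤ n.choose (k + 1) := by
  have h1 := Nat.choose_succ_right_eq n k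
  have h2 := Nat.choose_succ_right_eq n (k + 1)
  have hk : n - k ≤ k + 1 := by
    by_contra! hlt
    have : n.choose k * (n - k) ≤ n.choose k * (k + 1) := by
      rw [← h1]; gcongr
    have hpos : 0 < n.choose k := by omega
    have := Nat.le_of_mul_le_mul_left this hpos
    omega
  refine Nat.le_of_mul_le_mul_right (c := k + 2) ?_ (by omega)
  calc n.choose (k + 2) * (k + 2) = n.choose (k + 1) * (n - (k + 1)) := h2
    _ ≤ n.choose (k + 1) * (k + 2) := by gcongr; omega

theorem choose_le_of_succ_lt {n k : ℕ} (h : n.choose (k + 1) < n.choose (k + 2)) :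
    n.choose k ≤ n.choose (k + 1) := by
  by_contra! hlt
  exact absurd (choose_succ_lt_of_lt hlt) (by omega)

/-- The four properties need one another. At size `s + 1` the function for `(p, q)` concatenates two
neighbours of size `s`, whose comparison yields minimality and subadditivity; two neighbours of size
`s + 1` share one such piece, which yields their comparison. -/
theorem shadowSize_joint (s : ℕ) :
    (∀ p q, p + q = s → TailMinimal ((p + q).choose p) (shadowSize p q) ∧
      SubadditiveUpTo ((p + q).choose p) (shadowSize p q)) ∧
    (∀ p q, p + 1 + q = s →
      TailDominates ((p + 1 + q).choose (p + 1)) (shadowSize (p + 1) q)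
        ((p + (q + 1)).choose p) (shadowSize p (q + 1)) ∧
      Dominates ((p + 1 + q).choose (p + 1)) (shadowSize (p + 1) q)
        ((p + (q + 1)).choose p) (shadowSize p (q + 1))) := by
  induction s with
  | zero =>
    refine ⟨fun p q h => ?_, fun p q h => by omega⟩
    obtain rfl : p = 0 := by omega
    exact ⟨fun a c d _ _ _ => by simp [shadowSize_zero_left],
      fun u v _ => by simp [shadowSize_zero_left]⟩
  | succ s ih =>
    have PS : ∀ p q, p + q = s + 1 → TailMinimal ((p + q).choose p) (shadowSize p q) ∧
        SubadditiveUpTo ((p + q).choose p) (shadowSize p q) := by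
      intro p q h
      rcases p with - | p
      · exact ⟨fun a c d _ _ _ => by simp [shadowSize_zero_left],
          fun u v _ => by simp [shadowSize_zero_left]⟩
      rcases q with - | q
      · refine ⟨fun a c d _ _ h => ?_, fun u v _ => ?_⟩
        · simp only [shadowSize_zero_mid, ← add_mul]
          rw [h]
        · simp only [shadowSize_zero_mid, ← add_mul]
          exact le_rfl
      · rw [choose_split, shadowSize_succ_succ]
        have hf := ih.1 (p + 1) q (by omega)
        have hg := ih.1 p (q + 1) (by omega)
        have hfg := ih.2 p q (by omega)
        exact ⟨tailMinimal_glue (shadowSize_zero_right _ _) hf.1 hg.1 hg.2 hfg.1,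
          subadditiveUpTo_glue (shadowSize_zero_right _ _) hf.1 hf.2 hg.2 hfg.2⟩
    refine ⟨PS, fun p q h => ?_⟩
    rcases q with - | q
    · have hS := (PS p 1 (by omega)).2
      simp only [add_zero, Nat.choose_self]
      constructor
      · intro x i j hi hj
        simp only [zero_add] at hj ⊢
        simp only [shadowSize_zero_mid]
        have hx : x = 0 ∨ x = 1 := by omega
        rcases hx with rfl | rfl
        · obtain rfl : i = 1 := by omega
          rw [← hj, add_zero, add_comm]
        · obtain rfl : i = 0 := by omega
          have h1 := hS j 1 hj.le
          rw [hj, shadowSize_one] at h1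
          omega
      · intro v hv _
        have hx : v = 0 ∨ v = 1 := by omega
        rcases hx with rfl | rfl
        · rw [shadowSize_zero_right]; exact Nat.zero_le _
        · rw [shadowSize_one, shadowSize_one]; omega
    rcases p with - | p
    · refine ⟨fun x i j hi hj => ?_, fun v _ _ => by simp [shadowSize_zero_left]⟩
      simp only [shadowSize_zero_left]
      have := shadowSize_mono (0 + 1) (q + 1) (show i ≤ (0 + 1 + (q + 1)).choose (0 + 1) by omega)
      omega
    · rw [choose_split (p + 1) q, choose_split p (q + 1), shadowSize_succ_succ (p + 1) q,
        shadowSize_succ_succ p (q + 1), show p + 1 + 1 + q = p + 1 + (q + 1) by omega]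
      have hf := ih.1 (p + 1 + 1) q (by omega)
      have hg := ih.1 (p + 1) (q + 1) (by omega)
      have he := ih.1 p (q + 1 + 1) (by omega)
      have hfg := ih.2 (p + 1) q (by omega)
      have hge := ih.2 p (q + 1) (by omega)
      rw [show p + 1 + 1 + q = p + 1 + (q + 1) by omega] at hf hfg
      have hpq : p + (q + 1 + 1) = p + 1 + (q + 1) := by omega
      rw [hpq] at he hge ⊢
      have g0 := shadowSize_zero_right (p + 1) (q + 1)
      have e0 := shadowSize_zero_right p (q + 1 + 1)
      exact ⟨tailDominates_glue g0 e0 hf.1 hg.1 hg.2 he.2 hfg.1 hge.1 hge.2 choose_succ_lt_of_lt,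
        dominates_glue g0 e0 hf.1 hg.1 hg.2 hfg.1 hfg.2 hge.2 choose_le_of_succ_lt⟩

theorem shadowSize_add_le (p q a c d : ℕ) (ha : a ≤ (p + q).choose p) (hc : c ≤ (p + q).choose p)
    (h : a + c = (p + q).choose p + d) :
    shadowSize p q ((p + q).choose p) + shadowSize p q d ≤
      shadowSize p q a + shadowSize p q c :=
  ((shadowSize_joint _).1 p q rfl).1 a c d ha hc h

/-! ### Initial segments of colex order and Kruskal-Katona -/

open Finset.Colex

/-- Regard a subset of `Fin n` as a subset of `Fin (n + 1)`. -/
def lift {n : ℕ} (s : Finset (Fin n)) : Finset (Fin (n + 1)) := s.image Fin.castSucc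

/-- Regard a subset of `Fin n` as a subset of `Fin (n + 1)` and add the new element. -/
def liftInsert {n : ℕ} (s : Finset (Fin n)) : Finset (Fin (n + 1)) := insert (Fin.last n) (lift s)

section Lift

variable {n : ℕ} {s t : Finset (Fin n)}

@[simp] theorem castSucc_mem_lift {a : Fin n} : a.castSucc ∈ lift s ↔ a ∈ s := by simp [lift]

@[simp] theorem last_notMem_lift : Fin.last n ∉ lift s := by
  simp [lift, Fin.castSucc_ne_last]

@[simp] theorem castSucc_mem_liftInsert {a : Fin n} : a.castSucc ∈ liftInsert s ↔ a ∈ s := by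
  simp [liftInsert, Fin.castSucc_ne_last]

@[simp] theorem last_mem_liftInsert : Fin.last n ∈ liftInsert s := by simp [liftInsert]

theorem lift_injective : Function.Injective (lift (n := n)) :=
  image_injective (Fin.castSucc_injective n)

theorem liftInsert_injective : Function.Injective (liftInsert (n := n)) := by
  intro s t h
  ext a
  rw [← castSucc_mem_liftInsert, h, castSucc_mem_liftInsert]

theorem lift_ne_liftInsert : lift s ≠ liftInsert t := fun h =>
  last_notMem_lift (h ▸ last_mem_liftInsert : Fin.last n ∈ lift s)

theorem eq_lift_or_eq_liftInsert (u : Finset (Fin (n + 1))) :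
    ∃ s, u = lift s ∨ u = liftInsert s := by
  refine ⟨({a | Fin.castSucc a ∈ u} : Finset (Fin n)), ?_⟩
  by_cases h : Fin.last n ∈ u
  · right
    ext a
    refine Fin.lastCases ?_ (fun a => ?_) a <;> simp [h]
  · left
    ext a
    refine Fin.lastCases ?_ (fun a => ?_) a <;> simp [h]

@[simp] theorem card_lift : #(lift s) = #s :=
  card_image_of_injective _ (Fin.castSucc_injective n)

@[simp] theorem card_liftInsert : #(liftInsert s) = #s + 1 := by
  rw [liftInsert, card_insert_of_notMem last_notMem_lift, card_lift]

theorem insert_lift (a : Fin n) : insert a.castSucc (lift s) = lift (insert a s) := by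
  simp [lift, image_insert]

theorem insert_liftInsert (a : Fin n) :
    insert a.castSucc (liftInsert s) = liftInsert (insert a s) := by
  rw [liftInsert, Finset.insert_comm, insert_lift, liftInsert]

theorem toColex_lift_lt : toColex (lift s) < toColex (lift t) ↔ toColex s < toColex t :=
  toColex_image_lt_toColex_image Fin.strictMono_castSucc

theorem toColex_liftInsert_lt :
    toColex (liftInsert s) < toColex (liftInsert t) ↔ toColex s < toColex t := by
  have hs : liftInsert s \ {Fin.last n} = lift s := by
    rw [liftInsert, insert_sdiff_of_mem _ (mem_singleton_self _), sdiff_singleton_eq_erase,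
      erase_eq_of_notMem last_notMem_lift]
  have ht : liftInsert t \ {Fin.last n} = lift t := by
    rw [liftInsert, insert_sdiff_of_mem _ (mem_singleton_self _), sdiff_singleton_eq_erase,
      erase_eq_of_notMem last_notMem_lift]
  rw [← toColex_lift_lt (s := s), ← hs, ← ht, toColex_sdiff_lt_toColex_sdiff] <;> simp

theorem toColex_lift_lt_liftInsert : toColex (lift s) < toColex (liftInsert t) := by
  rw [toColex_lt_toColex_iff_exists_forall_lt]
  refine ⟨Fin.last n, last_mem_liftInsert, last_notMem_lift, fun b hb _ => ?_⟩
  refine (Fin.le_last b).lt_of_ne ?_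
  rintro rfl
  exact last_notMem_lift hb

end Lift

/-- The family on `Fin (n + 1)` whose members without the last element come from `F` and whose
members with the last element come from `G`. -/
def glueFamily {n : ℕ} (F G : Finset (Finset (Fin n))) : Finset (Finset (Fin (n + 1))) :=
  F.image lift ∪ G.image liftInsert

section GlueFamily

variable {n r : ℕ} {F G : Finset (Finset (Fin n))} {s : Finset (Fin n)}

@[simp] theorem lift_mem_glueFamily : lift s ∈ glueFamily F G ↔ s ∈ F := by
  simp [glueFamily, lift_injective.eq_iff, lift_ne_liftInsert.symm]

@[simp] theorem liftInsert_mem_glueFamily : liftInsert s ∈ glueFamily F G ↔ s ∈ G := by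
  simp [glueFamily, liftInsert_injective.eq_iff, lift_ne_liftInsert]

theorem card_glueFamily : #(glueFamily F G) = #F + #G := by
  rw [glueFamily, card_union_of_disjoint, card_image_of_injective _ lift_injective,
    card_image_of_injective _ liftInsert_injective]
  rw [disjoint_left]
  intro u hu hu'
  obtain ⟨s, -, rfl⟩ := mem_image.1 hu
  obtain ⟨t, -, h⟩ := mem_image.1 hu'
  exact lift_ne_liftInsert h.symm

/-- Deleting the last element from a member that has it gives the `G` in the lower part; every other
deletion stays in its part. -/
theorem shadow_glueFamily : ∂ (glueFamily F G) = glueFamily (∂ F ∪ G) (∂ G) := by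
  ext u
  obtain ⟨s, rfl | rfl⟩ := eq_lift_or_eq_liftInsert u
  · rw [lift_mem_glueFamily, mem_union, mem_shadow_iff_insert_mem, mem_shadow_iff_insert_mem,
      Fin.exists_fin_succ']
    simp only [castSucc_mem_lift, insert_lift, lift_mem_glueFamily, last_notMem_lift,
      not_false_eq_true, true_and]
    rw [show insert (Fin.last n) (lift s) = liftInsert s from rfl, liftInsert_mem_glueFamily]
  · rw [liftInsert_mem_glueFamily, mem_shadow_iff_insert_mem, mem_shadow_iff_insert_mem,
      Fin.exists_fin_succ']
    simp [insert_liftInsert]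

theorem isInitSeg_glueFamily_empty (hF : IsInitSeg F r) : IsInitSeg (glueFamily F ∅) r := by
  constructor
  · intro u hu
    obtain ⟨s, rfl | rfl⟩ := eq_lift_or_eq_liftInsert u
    · rw [card_lift]
      exact hF.1 (by simpa using hu)
    · simp at hu
  · intro u v hu hv
    obtain ⟨s, rfl | rfl⟩ := eq_lift_or_eq_liftInsert u
    · obtain ⟨t, rfl | rfl⟩ := eq_lift_or_eq_liftInsert v
      · rw [lift_mem_glueFamily] at hu ⊢
        rw [toColex_lift_lt, card_lift] at hv
        exact hF.2 hu hv
      · exact absurd hv.1 toColex_lift_lt_liftInsert.not_gt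
    · simp at hu

theorem isInitSeg_glueFamily_level (hG : IsInitSeg G r) :
    IsInitSeg (glueFamily (level n (r + 1)) G) (r + 1) := by
  constructor
  · intro u hu
    obtain ⟨s, rfl | rfl⟩ := eq_lift_or_eq_liftInsert u
    · rw [card_lift]
      simpa using hu
    · rw [card_liftInsert, hG.1 (by simpa using hu)]
  · intro u v hu hv
    obtain ⟨t, rfl | rfl⟩ := eq_lift_or_eq_liftInsert v
    · rw [card_lift] at hv
      simpa using hv.2
    · obtain ⟨s, rfl | rfl⟩ := eq_lift_or_eq_liftInsert u
      · exact absurd hv.1 toColex_lift_lt_liftInsert.not_gt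
      · rw [liftInsert_mem_glueFamily] at hu ⊢
        rw [toColex_liftInsert_lt, card_liftInsert, Nat.add_left_inj] at hv
        exact hG.2 hu hv

end GlueFamily

theorem card_level (n r : ℕ) : #(level n r) = n.choose r := by simp

theorem isInitSeg_level (n r : ℕ) : IsInitSeg (level n r) r :=
  ⟨fun s hs => by simpa using hs, fun s t _ h => by simpa using h.2⟩

theorem subset_level_of_sized {n r : ℕ} {F : Finset (Finset (Fin n))}
    (hF : (F : Set (Finset (Fin n))).Sized r) : F ⊆ level n r := fun s hs => by
  simpa using hF hs

theorem eq_level_of_card {n r : ℕ} {F : Finset (Finset (Fin n))}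
    (hF : (F : Set (Finset (Fin n))).Sized r) (h : #F = n.choose r) : F = level n r :=
  eq_of_subset_of_card_le (subset_level_of_sized hF) (by rw [card_level, h])

theorem shadow_level {n r : ℕ} (h : r < n) : ∂ (level n (r + 1)) = level n r := by
  apply Subset.antisymm
  · exact subset_level_of_sized ((isInitSeg_level n (r + 1)).1.shadow)
  · intro s hs
    have hs' : #s = r := by simpa using hs
    obtain ⟨a, ha⟩ : ∃ a, a ∉ s := by
      by_contra! hall
      have : s = univ := eq_univ_of_forall hall
      rw [this, card_univ, Fintype.card_fin] at hs'
      omega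
    rw [mem_shadow_iff_insert_mem]
    refine ⟨a, ha, ?_⟩
    simp [card_insert_of_notMem ha, hs']

/-- Colex order lists all sets without the last element first. Once they are exhausted their shadow
contains every `p`-set without that element, so later sets contribute only shadow sets that contain
it; this is the recursion of `shadowSize`. -/
theorem exists_isInitSeg_card_shadow (n p q i : ℕ) (hn : p + q = n) (hi : i ≤ n.choose p) :
    ∃ F : Finset (Finset (Fin n)), IsInitSeg F p ∧ #F = i ∧ #(∂ F) = shadowSize p q i := by
  induction n generalizing p q i with
  | zero =>
    obtain ⟨rfl, rfl⟩ : p = 0 ∧ q = 0 := by omega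
    rw [Nat.choose_self] at hi
    rw [shadowSize_zero_left]
    have : i = 0 ∨ i = 1 := by omega
    rcases this with rfl | rfl
    · exact ⟨∅, isInitSeg_empty, by simp, by simp⟩
    · refine ⟨level 0 0, isInitSeg_level 0 0, by simp, by simp [shadow_singleton_empty]⟩
  | succ n ih =>
    rcases i.eq_zero_or_pos with rfl | hi0
    · exact ⟨∅, isInitSeg_empty, by simp, by simp [shadowSize_zero_right]⟩
    rcases p with - | p
    · obtain rfl : i = 1 := by simp at hi; omega
      exact ⟨level (n + 1) 0, isInitSeg_level _ _, by simp,
        by simp [shadow_singleton_empty, shadowSize_zero_left]⟩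
    rcases q with - | q
    · obtain rfl : p = n := by omega
      obtain rfl : i = 1 := by simp at hi; omega
      exact ⟨level (p + 1) (p + 1), isInitSeg_level _ _, by simp,
        by rw [shadow_level (Nat.lt_succ_self p), card_level, shadowSize_one,
          Nat.choose_succ_self_right]⟩
    · obtain rfl : n = p + 1 + q := by omega
      rw [shadowSize_succ_succ]
      rcases le_or_gt i ((p + 1 + q).choose (p + 1)) with h | h
      · obtain ⟨F, hF, hc, hs⟩ := ih (p + 1) q i rfl h
        refine ⟨glueFamily F ∅, isInitSeg_glueFamily_empty hF, ?_, ?_⟩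
        · simp [card_glueFamily, hc]
        · simp [shadow_glueFamily, card_glueFamily, glue_of_le h, hs]
      · obtain ⟨j, rfl⟩ := Nat.exists_eq_add_of_le h.le
        have hsp := choose_split p q
        rw [show p + 1 + (q + 1) = p + 1 + q + 1 by omega] at hsp
        obtain ⟨G, hG, hc, hs⟩ := ih p (q + 1) j (by omega)
          (by rw [show p + 1 + q = p + (q + 1) by omega] at hi hsp ⊢; omega)
        obtain ⟨F, hF, hFc, hFs⟩ := ih (p + 1) q _ rfl le_rfl
        obtain rfl := eq_level_of_card hF.1 hFc
        refine ⟨glueFamily (level _ (p + 1)) G, isInitSeg_glueFamily_level hG, ?_, ?_⟩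
        · rw [card_glueFamily, hc, card_level]
        · rw [shadow_glueFamily, card_glueFamily, glue_add (shadowSize_zero_right _ _), hs,
            ← hFs, shadow_level (show p < p + 1 + q by omega),
            union_eq_left.2 (subset_level_of_sized hG.1)]

theorem firstSets_eq {n r i : ℕ} {F : Finset (Finset (Fin n))} (hF : IsInitSeg F r)
    (hc : #F = i) : firstSets n r i = F := by
  subst hc
  ext s
  rw [firstSets, mem_filter]
  constructor
  · rintro ⟨hs, hlt⟩
    by_contra hsF
    refine hlt.not_ge (card_le_card fun t ht => ?_)
    refine mem_filter.2 ⟨subset_level_of_sized hF.1 ht, ?_⟩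
    by_contra! hle
    rcases hle.lt_or_eq with h | h
    · exact hsF (hF.2 ht ⟨h, by simpa using hs⟩)
    · exact hsF (by rwa [toColex_inj.1 h])
  · intro hs
    refine ⟨subset_level_of_sized hF.1 hs, card_lt_card ⟨fun t ht => ?_, fun h => ?_⟩⟩
    · obtain ⟨h1, h2⟩ := mem_filter.1 ht
      exact hF.2 hs ⟨h2, by simpa using h1⟩
    · exact lt_irrefl _ (mem_filter.1 (h hs)).2

theorem firstSets_spec (p q i : ℕ) (hi : i ≤ (p + q).choose p) :
    IsInitSeg (firstSets (p + q) p i) p ∧ #(firstSets (p + q) p i) = i ∧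
      #(∂ (firstSets (p + q) p i)) = shadowSize p q i := by
  obtain ⟨F, hF, hc, hs⟩ := exists_isInitSeg_card_shadow (p + q) p q i rfl hi
  rw [firstSets_eq hF hc]
  exact ⟨hF, hc, hs⟩

theorem shadowSize_le_card_shadow {p q : ℕ} {F : Finset (Finset (Fin (p + q)))}
    (hF : (F : Set (Finset (Fin (p + q)))).Sized p) : shadowSize p q (#F) ≤ #(∂ F) := by
  have hi : #F ≤ (p + q).choose p := by
    rw [← card_level]
    exact card_le_card (subset_level_of_sized hF)
  obtain ⟨h1, h2, h3⟩ := firstSets_spec p q (#F) hi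
  rw [← h3]
  exact kruskal_katona hF h2.le h1

theorem kappa_eq {p q i : ℕ} (hi : i ≤ (p + q).choose p) :
    kappa (p + q) p i = (shadowSize p q i : ℤ) - i := by
  rw [kappa, (firstSets_spec p q i hi).2.2]

theorem shadowSize_le_choose {p q i : ℕ} (hi : i ≤ (p + 1 + q).choose (p + 1)) :
    shadowSize (p + 1) q i ≤ (p + 1 + q).choose p := by
  obtain ⟨h1, h2, h3⟩ := firstSets_spec (p + 1) q i hi
  rw [← h3, ← card_level]
  exact card_le_card (subset_level_of_sized h1.1.shadow)

/-! ### The middle level and the threshold -/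

theorem choose_odd_symm (h : ℕ) : (h + 1 + h).choose h = (h + 1 + h).choose (h + 1) := by
  rw [← Nat.choose_symm_add]

theorem choose_even_succ (h : ℕ) : (h + 1 + (h + 1)).choose (h + 1) =
    (h + 1 + h).choose (h + 1) + (h + 1 + h).choose (h + 1) := by
  rw [choose_split, show h + (h + 1) = h + 1 + h by omega, choose_odd_symm]

theorem choose_even_le (h : ℕ) : (h + h).choose h ≤ (h + 1 + h).choose (h + 1) := by
  rw [show h + 1 + h = h + h + 1 by omega, Nat.choose_succ_succ']
  omega

theorem threshold_succ (h : ℕ) :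
    threshold (h + 1) = (h + 1 + h).choose (h + 1) + threshold h := by
  rw [threshold, sum_Icc_succ_top (by omega), threshold,
    show 2 * (h + 1) - 1 = h + 1 + h by omega]
  omega

theorem threshold_le (h : ℕ) : threshold h ≤ (h + h).choose h := by
  induction h with
  | zero => simp [threshold]
  | succ h ih =>
    rw [threshold_succ, choose_even_succ]
    have := choose_even_le h
    omega

/-- Between levels `h + 1` and `h` of a `(2h+1)`-set the inclusion graph is regular of degree `h +
1`, so local LYM gives no loss. -/
theorem le_shadowSize_odd {h i : ℕ} (hi : i ≤ (h + 1 + h).choose (h + 1)) :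
    i ≤ shadowSize (h + 1) h i := by
  obtain ⟨h1, h2, h3⟩ := firstSets_spec (h + 1) h i hi
  have := local_lubell_yamamoto_meshalkin_inequality_mul h1.1
  rw [h2, h3, Fintype.card_fin, show h + 1 + h - (h + 1) + 1 = h + 1 by omega] at this
  exact Nat.le_of_mul_le_mul_right this (by omega)

theorem shadowSize_odd_full (h : ℕ) :
    shadowSize (h + 1) h ((h + 1 + h).choose (h + 1)) = (h + 1 + h).choose (h + 1) :=
  le_antisymm ((shadowSize_le_choose le_rfl).trans (choose_odd_symm h).le)
    (le_shadowSize_odd le_rfl)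

/-- The sets avoiding the largest element contribute equally to family and shadow. The next ones
contain it and, for `j` in this range, avoid the second largest, so the problem repeats with two
fewer elements. This self-similarity produces the sum defining `threshold`, the first place where
the shadow is smaller than the family. -/
theorem shadowSize_even_add {h j : ℕ} (hj : j ≤ (h + h).choose h) :
    shadowSize (h + 1) (h + 1) ((h + 1 + h).choose (h + 1) + j) =
      (h + 1 + h).choose (h + 1) + shadowSize h h j := by
  rw [shadowSize_succ_succ, glue_add (shadowSize_zero_right _ _), shadowSize_odd_full]
  congr 1
  rcases h with - | h
  · simp [shadowSize_zero_left]
  · rw [shadowSize_succ_succ h (h + 1), glue_of_le hj]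

theorem le_shadowSize_of_lt_threshold {h i : ℕ} (hi : i < threshold h) :
    i ≤ shadowSize h h i := by
  induction h generalizing i with
  | zero => simp [threshold] at hi; omega
  | succ h ih =>
    rw [threshold_succ] at hi
    rcases le_total i ((h + 1 + h).choose (h + 1)) with hz | hz
    · rw [shadowSize_succ_succ, glue_of_le hz]
      exact le_shadowSize_odd hz
    · obtain ⟨j, rfl⟩ := Nat.exists_eq_add_of_le hz
      have := threshold_le h
      rw [shadowSize_even_add (by omega)]
      have := ih (i := j) (by omega)
      omega

theorem shadowSize_threshold (h : ℕ) : shadowSize h h (threshold h) + 1 = threshold h := by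
  induction h with
  | zero => simp [threshold, shadowSize_zero_left]
  | succ h ih =>
    rw [threshold_succ, shadowSize_even_add (threshold_le h)]
    omega

theorem isAntichain_level_sdiff_shadow_union {n r : ℕ} {F : Finset (Finset (Fin n))}
    (hF : (F : Set (Finset (Fin n))).Sized (r + 1)) :
    IsAntichain (· ⊆ ·) (((level n r \ ∂ F) ∪ F : Finset (Finset (Fin n))) :
      Set (Finset (Fin n))) := by
  intro s hs t ht hne hst
  simp only [coe_union, Set.mem_union, mem_coe, mem_sdiff, mem_powersetCard_univ] at hs ht
  have hlt := card_lt_card (hst.ssubset_of_ne hne)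
  rcases hs with hs | hs <;> rcases ht with ht | ht
  · omega
  · refine hs.2 (mem_shadow_iff_exists_mem_card_add_one.2 ⟨t, ht, hst, ?_⟩)
    rw [hF ht, hs.1]
  · rw [hF hs] at hlt
    omega
  · rw [hF hs, hF ht] at hlt
    omega

/-- Sperner's theorem for the antichain obtained from level `h` by replacing the shadow of the first
`i` sets with these sets. -/
theorem choose_add_le_shadowSize_add {h i : ℕ}
    (hi : i ≤ (h + 1 + (h + 1)).choose (h + 1)) :
    (h + 1 + (h + 1)).choose h + i ≤
      (h + 1 + (h + 1)).choose (h + 1) + shadowSize (h + 1) (h + 1) i := by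
  obtain ⟨h1, h2, h3⟩ := firstSets_spec (h + 1) (h + 1) i hi
  have hsp := (isAntichain_level_sdiff_shadow_union h1.1).sperner
  rw [Fintype.card_fin, show (h + 1 + (h + 1)) / 2 = h + 1 by omega, card_union_of_disjoint,
    card_sdiff_of_subset (show ∂ _ ⊆ level _ h from subset_level_of_sized h1.1.shadow),
    card_level, h2, h3] at hsp
  · omega
  · rw [disjoint_left]
    intro s hs hs'
    have e1 : #s = h := by simpa using (mem_sdiff.1 hs).1
    have e2 := h1.1 hs'
    omega

theorem shadowSize_even_full (h : ℕ) :
    shadowSize (h + 1) (h + 1) ((h + 1 + (h + 1)).choose (h + 1)) =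
      (h + 1 + (h + 1)).choose h := by
  have h1 := choose_add_le_shadowSize_add (h := h) le_rfl
  have h2 := shadowSize_le_choose (p := h) (q := h + 1) le_rfl
  omega

theorem kappaStar_le {n r i j : ℕ} (h : j ≤ i) : kappaStar n r i ≤ kappa n r j :=
  inf'_le _ (by simpa [Nat.lt_succ_iff] using h)

theorem kappa_zero (p q : ℕ) : kappa (p + q) p 0 = 0 := by
  rw [kappa_eq (Nat.zero_le _), shadowSize_zero_right]
  simp

theorem kappaStar_nonpos (p q i : ℕ) : kappaStar (p + q) p i ≤ 0 :=
  (kappaStar_le (Nat.zero_le i)).trans (kappa_zero p q).le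

/-- The inequality between values of the Kruskal-Katona function to which the bound on pairs of
families reduces. -/
theorem choose_add_kappaStar_le {h k a c : ℕ} (ha : a ≤ (h + 1 + (h + 1)).choose (h + 1))
    (hc : c ≤ (h + 1 + (h + 1)).choose (h + 1))
    (hac : a + c ≤ (h + 1 + (h + 1)).choose (h + 1) + k) :
    ((h + 1 + (h + 1)).choose h : ℤ) + kappaStar (h + 1 + (h + 1)) (h + 1) k + a + c ≤
      (h + 1 + (h + 1)).choose (h + 1) +
        shadowSize (h + 1) (h + 1) a + shadowSize (h + 1) (h + 1) c := by
  have hk := kappaStar_nonpos (h + 1) (h + 1) k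
  have ha' := choose_add_le_shadowSize_add ha
  have hc' := choose_add_le_shadowSize_add hc
  by_cases hat : a < threshold (h + 1)
  · have := le_shadowSize_of_lt_threshold hat
    omega
  by_cases hct : c < threshold (h + 1)
  · have := le_shadowSize_of_lt_threshold hct
    omega
  -- Twice the threshold is at least the size of the middle level, so the excess `d` of `a + c`
  -- exists, and `d ≤ k`.
  have ht := threshold_succ h
  have hN := choose_even_succ h
  obtain ⟨d, hd⟩ := Nat.exists_eq_add_of_le
    (show (h + 1 + (h + 1)).choose (h + 1) ≤ a + c by omega)
  have h1 := shadowSize_add_le (h + 1) (h + 1) a c d ha hc hd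
  rw [shadowSize_even_full] at h1
  have h2 : kappaStar (h + 1 + (h + 1)) (h + 1) k ≤ _ := kappaStar_le (show d ≤ k by omega)
  rw [kappa_eq (by omega)] at h2
  omega

/-! ### Pushing antichains to the middle -/

/-- Going down level by level, passing to the shadow does not shrink a family lying above the
middle, and the antichain property keeps this shadow disjoint from the members of `C` on the new
level. -/
theorem card_filter_le_card_falling {n k : ℕ} {C : Finset (Finset (Fin n))}
    (hC : IsAntichain (· ⊆ ·) (C : Set (Finset (Fin n)))) (hk : n ≤ 2 * k + 1) :
    #{c ∈ C | k ≤ #c} ≤ #(falling k C) := by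
  by_cases hn : n < k
  · rw [filter_false_of_mem]
    · simp
    · intro c _ hkc
      have := card_le_univ c
      rw [Fintype.card_fin] at this
      omega
  · have ih := card_filter_le_card_falling (k := k + 1) hC (by omega)
    have hsplit : {c ∈ C | k ≤ #c} = C # k ∪ {c ∈ C | k + 1 ≤ #c} := by
      ext c
      simp only [mem_filter, mem_union, mem_slice, ← and_or_left]
      refine and_congr_right fun _ => ?_
      omega
    have hlym := local_lubell_yamamoto_meshalkin_inequality_mul (sized_falling (k + 1) C)
    rw [Fintype.card_fin] at hlym
    have hgrow : #(falling (k + 1) C) ≤ #(∂ (falling (k + 1) C)) := by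
      refine Nat.le_of_mul_le_mul_right (hlym.trans ?_) (Nat.succ_pos k)
      gcongr
      omega
    rw [hsplit, ← slice_union_shadow_falling_succ,
      card_union_of_disjoint (IsAntichain.disjoint_slice_shadow_falling hC)]
    exact (card_union_le _ _).trans (by omega)
termination_by n + 1 - k

theorem isAntichain_compls {n : ℕ} {C : Finset (Finset (Fin n))}
    (hC : IsAntichain (· ⊆ ·) (C : Set (Finset (Fin n)))) :
    IsAntichain (· ⊆ ·) ((Cᶜˢ : Finset (Finset (Fin n))) : Set (Finset (Fin n))) := by
  intro s hs t ht hne hst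
  rw [mem_coe, mem_compls] at hs ht
  exact hC ht hs (fun h => hne (compl_injective h).symm) (compl_subset_compl.2 hst)

/-- The members of size at least `h + 1` are pushed down to level `h + 1`, the others up to level
`h`. The latter image is disjoint from the shadow of the former, as a common set would lie between
two members of the antichain; so both fit into level `h`. -/
theorem card_add_card_shadow_falling_le {h : ℕ} {C : Finset (Finset (Fin (h + 1 + (h + 1))))}
    (hC : IsAntichain (· ⊆ ·) (C : Set (Finset (Fin (h + 1 + (h + 1)))))) :
    #C + #(∂ (falling (h + 1) C)) ≤ #(falling (h + 1) C) + (h + 1 + (h + 1)).choose h := by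
  have h1 := card_filter_le_card_falling (k := h + 1) hC (by omega)
  have h2 := card_filter_le_card_falling (k := h + 2) (isAntichain_compls hC) (by omega)
  have h3 : #{c ∈ Cᶜˢ | h + 2 ≤ #c} = #{c ∈ C | ¬ h + 1 ≤ #c} := by
    rw [← card_compls]
    congr 1
    ext s
    simp only [mem_filter, mem_compls, compl_compl, card_compl, Fintype.card_fin]
    refine and_congr_right fun _ => ?_
    have := card_le_univ s
    rw [Fintype.card_fin] at this
    omega
  have h4 := card_filter_add_card_filter_not (s := C) (fun c => h + 1 ≤ #c)
  have h5 : #((falling (h + 2) Cᶜˢ)ᶜˢ ∪ ∂ (falling (h + 1) C)) ≤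
      (h + 1 + (h + 1)).choose h := by
    rw [← card_level]
    refine card_le_card (union_subset (fun s hs => ?_)
      (subset_level_of_sized ((sized_falling (h + 1) C).shadow)))
    rw [mem_compls] at hs
    have := sized_falling _ _ hs
    rw [card_compl, Fintype.card_fin] at this
    rw [mem_powersetCard_univ]
    omega
  rw [card_union_of_disjoint, card_compls] at h5
  · omega
  · rw [disjoint_left]
    intro s hs hs'
    rw [mem_compls, mem_falling] at hs
    obtain ⟨⟨t, ht, hst⟩, -⟩ := hs
    rw [mem_compls] at ht
    have hts : tᶜ ⊆ s := by simpa using compl_subset_compl.2 hst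
    obtain ⟨u, hu, a, ha, rfl⟩ := mem_shadow_iff.1 hs'
    obtain ⟨⟨c, hc, huc⟩, -⟩ := mem_falling.1 hu
    have htu := hts.trans (erase_subset a u)
    have htc : tᶜ = c := by
      by_contra hne
      exact hC ht hc hne (htu.trans huc)
    exact notMem_erase a u (hts (htc ▸ huc ha))

/-! ### The upper bound for pairs -/

theorem card_add_card_le_of_forall_not_ssubset {h k : ℕ}
    {A C : Finset (Finset (Fin (h + 1 + (h + 1))))}
    (hA : IsAntichain (· ⊆ ·) (A : Set (Finset (Fin (h + 1 + (h + 1))))))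
    (hC : IsAntichain (· ⊆ ·) (C : Set (Finset (Fin (h + 1 + (h + 1))))))
    (hAC : ∀ a ∈ A, ∀ c ∈ C, a ⊆ c → a = c) (hk : #(A ∩ C) ≤ k) :
    (#A : ℤ) + #C ≤ (h + 1 + (h + 1)).choose (h + 1) + (h + 1 + (h + 1)).choose h -
      kappaStar (h + 1 + (h + 1)) (h + 1) k := by
  have h1 := card_add_card_shadow_falling_le (isAntichain_compls hA)
  have h2 := card_add_card_shadow_falling_le hC
  have s1 := sized_falling (h + 1) Aᶜˢ
  have s2 := sized_falling (h + 1) C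
  have s3 : ((falling (h + 1) Aᶜˢ)ᶜˢ : Finset (Finset (Fin (h + 1 + (h + 1))))) ⊆
      level _ (h + 1) := by
    intro s hs
    have := s1 (mem_compls.1 hs)
    rw [card_compl, Fintype.card_fin] at this
    rw [mem_powersetCard_univ]
    omega
  -- A common middle set `s` satisfies `a ⊆ s ⊆ c` with `a ∈ A` and `c ∈ C`, which forces `a = s =
  -- c`.
  have h3 : #((falling (h + 1) Aᶜˢ)ᶜˢ ∩ falling (h + 1) C) ≤ k := by
    refine (card_le_card fun s hs => ?_).trans hk
    rw [mem_inter, mem_compls, mem_falling, mem_falling] at hs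
    obtain ⟨⟨⟨t, ht, hst⟩, -⟩, ⟨c, hc, hsc⟩, -⟩ := hs
    rw [mem_compls] at ht
    have hts : tᶜ ⊆ s := by simpa using compl_subset_compl.2 hst
    have htc := hAC _ ht _ hc (hts.trans hsc)
    obtain rfl : s = c := Subset.antisymm hsc (htc ▸ hts)
    exact mem_inter.2 ⟨htc ▸ ht, hc⟩
  have h4 : #((falling (h + 1) Aᶜˢ)ᶜˢ ∪ falling (h + 1) C) ≤
      (h + 1 + (h + 1)).choose (h + 1) := by
    rw [← card_level]
    exact card_le_card (union_subset s3 (subset_level_of_sized s2))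
  have h5 := card_union_add_card_inter (falling (h + 1) Aᶜˢ)ᶜˢ (falling (h + 1) C)
  rw [card_compls] at h5 h1
  have l1 := card_le_card (subset_level_of_sized s1)
  have l2 := card_le_card (subset_level_of_sized s2)
  rw [card_level] at l1 l2
  have h6 := choose_add_kappaStar_le (k := k) l1 l2 (by omega)
  have h7 := shadowSize_le_card_shadow s1
  have h8 := shadowSize_le_card_shadow s2
  omega

/-- Uncrossing: take the maximal members `U` of `A ∪ C`, and the other members together with `A ∩
C`. Sets of `A ∩ C` are comparable to nothing else, and a chain among the non-maximal members would
extend to three sets, two of them in `A` or two in `C`. -/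
theorem card_add_card_le_of_card_inter_le {h k : ℕ}
    {A C : Finset (Finset (Fin (h + 1 + (h + 1))))}
    (hA : IsAntichain (· ⊆ ·) (A : Set (Finset (Fin (h + 1 + (h + 1))))))
    (hC : IsAntichain (· ⊆ ·) (C : Set (Finset (Fin (h + 1 + (h + 1))))))
    (hk : #(A ∩ C) ≤ k) :
    (#A : ℤ) + #C ≤ (h + 1 + (h + 1)).choose (h + 1) + (h + 1 + (h + 1)).choose h -
      kappaStar (h + 1 + (h + 1)) (h + 1) k := by
  have hchain : ∀ x ∈ A ∪ C, ∀ y ∈ A ∪ C, ∀ z ∈ A ∪ C, x ⊂ y → y ⊂ z → False := by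
    intro x hx y hy z hz hxy hyz
    have hA' : ∀ s ∈ A, ∀ t ∈ A, ¬ s ⊂ t := fun s hs t ht hst => hA hs ht hst.ne hst.subset
    have hC' : ∀ s ∈ C, ∀ t ∈ C, ¬ s ⊂ t := fun s hs t ht hst => hC hs ht hst.ne hst.subset
    have hxz := hxy.trans hyz
    rw [mem_union] at hx hy hz
    rcases hx with hx | hx <;> rcases hy with hy | hy <;> rcases hz with hz | hz
    all_goals first
      | exact hA' _ hx _ hy hxy
      | exact hA' _ hy _ hz hyz
      | exact hA' _ hx _ hz hxz
      | exact hC' _ hx _ hy hxy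
      | exact hC' _ hy _ hz hyz
      | exact hC' _ hx _ hz hxz
  have hisol : ∀ x ∈ A ∩ C, ∀ y ∈ A ∪ C, x ⊆ y ∨ y ⊆ x → x = y := by
    intro x hx y hy hxy
    rw [mem_inter] at hx
    by_contra hne
    rcases mem_union.1 hy with hy | hy
    · rcases hxy with hxy | hxy
      · exact hA hx.1 hy hne hxy
      · exact hA hy hx.1 (Ne.symm hne) hxy
    · rcases hxy with hxy | hxy
      · exact hC hx.2 hy hne hxy
      · exact hC hy hx.2 (Ne.symm hne) hxy
  set U := {x ∈ A ∪ C | ∀ y ∈ A ∪ C, x ⊆ y → x = y} with hU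
  have hUsub : U ⊆ A ∪ C := filter_subset _ _
  have hIU : A ∩ C ⊆ U := fun x hx => mem_filter.2
    ⟨mem_union_left _ (mem_inter.1 hx).1, fun y hy hxy => hisol x hx y hy (Or.inl hxy)⟩
  have hdisj : Disjoint ((A ∪ C) \ U) (A ∩ C) := disjoint_left.2 fun x hx hx' =>
    (mem_sdiff.1 hx).2 (hIU hx')
  have hLsub : ((A ∪ C) \ U) ∪ (A ∩ C) ⊆ A ∪ C :=
    union_subset sdiff_subset (hIU.trans hUsub)
  have hcard : #U + #(((A ∪ C) \ U) ∪ (A ∩ C)) = #A + #C := by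
    rw [card_union_of_disjoint hdisj, ← card_union_add_card_inter A C, ← add_assoc,
      add_comm (#U), card_sdiff_add_card_eq_card hUsub]
  have hinter : U ∩ (((A ∪ C) \ U) ∪ (A ∩ C)) ⊆ A ∩ C := by
    intro x hx
    rw [mem_inter, mem_union, mem_sdiff] at hx
    exact hx.2.resolve_left fun h => h.2 hx.1
  have key := card_add_card_le_of_forall_not_ssubset (k := k) (A := U)
    (C := ((A ∪ C) \ U) ∪ (A ∩ C)) ?_ ?_ ?_ ((card_le_card hinter).trans hk)
  · omega
  · intro x hx y hy hne hxy
    exact hne ((mem_filter.1 hx).2 y (hUsub hy) hxy)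
  · intro x hx y hy hne hxy
    have hx' := hLsub hx
    have hy' := hLsub hy
    rcases mem_union.1 hx with hx | hx
    · rcases mem_union.1 hy with hy | hy
      · have hyU := (mem_sdiff.1 hy).2
        rw [hU, mem_filter, not_and] at hyU
        have := hyU hy'
        push Not at this
        obtain ⟨z, hz, hyz, hyne⟩ := this
        exact hchain x hx' y hy' z hz (hxy.ssubset_of_ne hne) (hyz.ssubset_of_ne hyne)
      · exact hne (hisol y hy x hx' (Or.inr hxy)).symm
    · exact hne (hisol x hx y hy' (Or.inl hxy))
  · intro x hx y hy hxy
    exact (mem_filter.1 hx).2 y (hLsub hy) hxy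

theorem card_inter_compls_le_of_atMostDisjointPairs {n k : ℕ} {A B : Finset (Finset (Fin n))}
    (hAB : AtMostDisjointPairs k A B) : #(A ∩ Bᶜˢ) ≤ k := by
  obtain ⟨a, b, hab⟩ := hAB
  have hidx : ∀ s ∈ A ∩ Bᶜˢ, ∃ i : Fin (#A), (i : ℕ) < k ∧ (a i : Finset (Fin n)) = s := by
    intro s hs
    rw [mem_inter, mem_compls] at hs
    refine ⟨a.symm ⟨s, hs.1⟩, ?_, by simp⟩
    exact (hab (a.symm ⟨s, hs.1⟩) (b.symm ⟨sᶜ, hs.2⟩) (by simp)).2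
  calc #(A ∩ Bᶜˢ) ≤ #(({i : Fin (#A) | (i : ℕ) < k} : Finset (Fin (#A))).image
        fun i => (a i : Finset (Fin n))) := by
        refine card_le_card fun s hs => ?_
        obtain ⟨i, hi, rfl⟩ := hidx s hs
        exact mem_image.2 ⟨i, by simpa using hi, rfl⟩
    _ ≤ #({i : Fin (#A) | (i : ℕ) < k} : Finset (Fin (#A))) := card_image_le
    _ = #(({i : Fin (#A) | (i : ℕ) < k} : Finset (Fin (#A))).image Fin.val) :=
        (card_image_of_injective _ Fin.val_injective).symm
    _ ≤ #(range k) := card_le_card fun i hi => by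
        obtain ⟨j, hj, rfl⟩ := mem_image.1 hi
        simpa using hj
    _ = k := card_range k

theorem card_inter_compls_le_card_disjoint {n : ℕ} (A B : Finset (Finset (Fin n))) :
    #(A ∩ Bᶜˢ) ≤ #{p ∈ A ×ˢ B | p.1 ∩ p.2 = ∅} := by
  refine card_le_card_of_injOn (fun s => (s, sᶜ)) (fun s hs => ?_)
    (fun s _ t _ hst => (Prod.ext_iff.1 hst).1)
  rw [mem_coe, mem_inter, mem_compls] at hs
  simp [hs.1, hs.2]

theorem card_add_card_le_of_card_inter_compls_le {h k : ℕ}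
    {A B : Finset (Finset (Fin (h + 1 + (h + 1))))}
    (hA : IsAntichain (· ⊆ ·) (A : Set (Finset (Fin (h + 1 + (h + 1))))))
    (hB : IsAntichain (· ⊆ ·) (B : Set (Finset (Fin (h + 1 + (h + 1))))))
    (hk : #(A ∩ Bᶜˢ) ≤ k) :
    (#A : ℤ) + #B ≤ (h + 1 + (h + 1)).choose (h + 1) + (h + 1 + (h + 1)).choose (h + 1 + 1) -
      kappaStar (h + 1 + (h + 1)) (h + 1) k := by
  have := card_add_card_le_of_card_inter_le hA (isAntichain_compls hB) hk
  rwa [card_compls, ← Nat.choose_symm_of_eq_add (show h + 1 + (h + 1) = h + 1 + 1 + h by omega)]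
    at this

/-! ### Sign of the correction term and extremal pairs -/

theorem kappaStar_eq_zero {h k : ℕ} (hk : k < threshold h) : kappaStar (h + h) h k = 0 := by
  refine le_antisymm (kappaStar_nonpos h h k) (le_inf' _ _ fun j hj => ?_)
  have hj' : j ≤ k := by simpa [Nat.lt_succ_iff] using hj
  have h1 := threshold_le h
  have h2 := le_shadowSize_of_lt_threshold (show j < threshold h by omega)
  rw [kappa_eq (by omega)]
  omega

theorem kappaStar_neg {h k : ℕ} (hk : threshold h ≤ k) : kappaStar (h + h) h k < 0 := by
  refine (kappaStar_le hk).trans_lt ?_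
  have := shadowSize_threshold h
  rw [kappa_eq (threshold_le h)]
  omega

theorem toColex_compl_lt_toColex_compl {n : ℕ} {s t : Finset (Fin n)} :
    toColex sᶜ < toColex tᶜ ↔ toColex t < toColex s := by
  rw [← toColex_sdiff_lt_toColex_sdiff', compl_sdiff_compl, compl_sdiff_compl,
    toColex_sdiff_lt_toColex_sdiff']

/-- Complementation reverses colex order, so shades of last sets are complements of shadows of first
sets. -/
theorem lastSets_eq_compls (p q m : ℕ) :
    lastSets (p + q) q m = (firstSets (p + q) p m)ᶜˢ := by
  have hlev : ∀ s : Finset (Fin (p + q)), s ∈ level (p + q) q ↔ sᶜ ∈ level (p + q) p := by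
    intro s
    have := card_le_univ s
    rw [Fintype.card_fin] at this
    simp only [mem_powersetCard_univ, card_compl, Fintype.card_fin]
    omega
  ext s
  rw [mem_compls, lastSets, firstSets, mem_filter, mem_filter, hlev,
    ← card_compls {T ∈ level (p + q) q | toColex s < toColex T}]
  have : ({T ∈ level (p + q) q | toColex s < toColex T} : Finset (Finset (Fin (p + q))))ᶜˢ =
      {T ∈ level (p + q) p | toColex T < toColex sᶜ} := by
    ext t
    rw [mem_compls, mem_filter, mem_filter, hlev, compl_compl, ← toColex_compl_lt_toColex_compl,
      compl_compl]
  rw [this]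

theorem lastSets_spec (p q m : ℕ) (hm : m ≤ (p + q).choose p) :
    ((lastSets (p + q) q m : Finset (Finset (Fin (p + q)))) : Set (Finset (Fin (p + q)))).Sized q ∧
      #(lastSets (p + q) q m) = m ∧ #(∂⁺ (lastSets (p + q) q m)) = shadowSize p q m := by
  obtain ⟨-, h2, h3⟩ := firstSets_spec p q m hm
  refine ⟨fun s hs => ?_, ?_, ?_⟩
  · exact mem_powersetCard_univ.1 (mem_filter.1 hs).1
  · rw [lastSets_eq_compls, card_compls, h2]
  · rw [lastSets_eq_compls, upShadow_compls, card_compls, h3]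

theorem isAntichain_of_sized {n r : ℕ} {F : Finset (Finset (Fin n))}
    (hF : (F : Set (Finset (Fin n))).Sized r) :
    IsAntichain (· ⊆ ·) (F : Set (Finset (Fin n))) := fun _ hs _ ht hne hst =>
  hne (eq_of_subset_of_card_le hst (by rw [hF hs, hF ht]))

theorem sized_level (n r : ℕ) : (level n r : Set (Finset (Fin n))).Sized r :=
  (isInitSeg_level n r).1

theorem isAntichain_union_level_sdiff_upShadow {n r : ℕ} {L : Finset (Finset (Fin n))}
    (hL : (L : Set (Finset (Fin n))).Sized r) :
    IsAntichain (· ⊆ ·) ((L ∪ (level n (r + 1) \ ∂⁺ L) : Finset (Finset (Fin n))) :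
      Set (Finset (Fin n))) := by
  intro s hs t ht hne hst
  simp only [coe_union, Set.mem_union, mem_coe, mem_sdiff, mem_powersetCard_univ] at hs ht
  have hlt := card_lt_card (hst.ssubset_of_ne hne)
  rcases hs with hs | hs <;> rcases ht with ht | ht
  · rw [hL hs, hL ht] at hlt
    omega
  · refine ht.2 (mem_upShadow_iff_exists_mem_card_add_one.2 ⟨s, hs, hst, ?_⟩)
    rw [hL hs, ht.1]
  · rw [hL ht] at hlt
    omega
  · omega

theorem card_union_level_sdiff_upShadow {n r : ℕ} {L : Finset (Finset (Fin n))}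
    (hL : (L : Set (Finset (Fin n))).Sized r) :
    #(L ∪ (level n (r + 1) \ ∂⁺ L)) + #(∂⁺ L) = #L + n.choose (r + 1) := by
  rw [card_union_of_disjoint, add_assoc,
    card_sdiff_add_card_eq_card (subset_level_of_sized hL.upShadow), card_level]
  rw [disjoint_left]
  intro s hs hs'
  have h1 := hL hs
  have h2 : #s = r + 1 := mem_powersetCard_univ.1 (mem_sdiff.1 hs').1
  omega

theorem inter_nonempty_of_card_lt {n : ℕ} {s t : Finset (Fin n)} (h : n < #s + #t) :
    s ∩ t ≠ ∅ := by
  intro he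
  have h1 := card_union_add_card_inter s t
  have h2 := card_le_univ (s ∪ t)
  rw [he, card_empty] at h1
  rw [Fintype.card_fin] at h2
  omega

/-- If the members of `B` disjoint from some member of `A` lie in `L ⊆ B`, and each member of `L` is
disjoint from its complement only, then the members of `L` and their complements can be listed
first. -/
theorem atMostDisjointPairs_of_compl {n k : ℕ} {A B L : Finset (Finset (Fin n))} (hLB : L ⊆ B)
    (hLA : Lᶜˢ ⊆ A) (hk : #L ≤ k)
    (hdisj : ∀ s ∈ A, ∀ t ∈ B, s ∩ t = ∅ → t ∈ L ∧ s = tᶜ) :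
    AtMostDisjointPairs k A B := by
  have hcA : #L ≤ #A := by rw [← card_compls]; exact card_le_card hLA
  have hcB : #L ≤ #B := card_le_card hLB
  let e := L.equivFin.symm
  let f : ℕ → Finset (Fin n) := fun i => if h : i < #L then e ⟨i, h⟩ else ∅
  have hf : ∀ i (h : i < #L), f i = e ⟨i, h⟩ := fun i h => dif_pos h
  have hfL : ∀ i, i < #L → f i ∈ L := fun i h => by rw [hf i h]; exact (e ⟨i, h⟩).2
  have hinj : ∀ i j, i < #L → j < #L → f i = f j → i = j := by
    intro i j hi hj hij
    rw [hf i hi, hf j hj] at hij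
    simpa using e.injective (Subtype.ext hij)
  have hsurj : ∀ t ∈ L, ∃ i, i < #L ∧ f i = t := by
    intro t ht
    refine ⟨e.symm ⟨t, ht⟩, (e.symm ⟨t, ht⟩).2, ?_⟩
    rw [hf _ (e.symm ⟨t, ht⟩).2]
    simp
  obtain ⟨b, hb⟩ := exists_equiv_extend_of_card_eq (t := B) (Fintype.card_fin (#B))
    (s := {i : Fin (#B) | (i : ℕ) < #L}) (f := fun i => f i)
    (image_subset_iff.2 fun i hi => hLB (hfL _ (mem_filter.1 hi).2))
    (fun i hi j hj hij => Fin.ext (hinj _ _ (by simpa using hi) (by simpa using hj) hij))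
  obtain ⟨a, ha⟩ := exists_equiv_extend_of_card_eq (t := A) (Fintype.card_fin (#A))
    (s := {i : Fin (#A) | (i : ℕ) < #L}) (f := fun i => (f i)ᶜ)
    (image_subset_iff.2 fun i hi => hLA (by
      rw [mem_compls, compl_compl]
      exact hfL _ (mem_filter.1 hi).2))
    (fun i hi j hj hij => Fin.ext (hinj _ _ (by simpa using hi) (by simpa using hj)
      (compl_injective hij)))
  refine ⟨a, b, fun i j hij => ?_⟩
  -- The two sets of a disjoint pair are a member of `L` and its complement, which stand at the same
  -- index `l < #L` of both enumerations.
  obtain ⟨hjL, hac⟩ := hdisj _ (a i).2 _ (b j).2 hij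
  obtain ⟨l, hl, hfl⟩ := hsurj _ hjL
  have hbl : b ⟨l, hl.trans_le hcB⟩ = b j := Subtype.ext (by
    rw [hb ⟨l, hl.trans_le hcB⟩ (by simpa using hl), hfl])
  have hal : a ⟨l, hl.trans_le hcA⟩ = a i := Subtype.ext (by
    rw [ha ⟨l, hl.trans_le hcA⟩ (by simpa using hl), hfl, hac])
  have h1 := congrArg Fin.val (b.injective hbl)
  have h2 := congrArg Fin.val (a.injective hal)
  simp only at h1 h2
  omega

theorem admissible_level_level {h k : ℕ} (hk : k < threshold (h + 1)) :
    Admissible k (level (h + 1 + (h + 1)) (h + 1)) (level (h + 1 + (h + 1)) (h + 1 + 1)) where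
  antichain_left := isAntichain_of_sized (sized_level _ _)
  antichain_right := isAntichain_of_sized (sized_level _ _)
  le_card := by
    -- The first `threshold (h + 1)` sets have a shadow of exactly one set less, and it lies in
    -- level `h`; hence `k ≤ C(n,h) = C(n,h+2)`.
    have h1 := threshold_le (h + 1)
    have h2 := shadowSize_threshold (h + 1)
    have h3 := shadowSize_le_choose h1
    rw [card_level, card_level, le_min_iff,
      Nat.choose_symm_of_eq_add (show h + 1 + (h + 1) = h + 1 + 1 + h by omega)]
    omega
  disjoint_pairs := by
    refine atMostDisjointPairs_of_compl (L := ∅) (empty_subset _) (by simp) (by simp)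
      fun s hs t ht hst => absurd hst (inter_nonempty_of_card_lt ?_)
    rw [sized_level _ _ hs, sized_level _ _ ht]
    omega

theorem card_union_lastSets {h m : ℕ} (hm : m ≤ (h + 1 + (h + 1)).choose (h + 1)) :
    (#(lastSets (h + 1 + (h + 1)) (h + 1) m ∪ (level (h + 1 + (h + 1)) (h + 1 + 1) \
      ∂⁺ (lastSets (h + 1 + (h + 1)) (h + 1) m))) : ℤ) =
      (h + 1 + (h + 1)).choose (h + 1 + 1) - kappa (h + 1 + (h + 1)) (h + 1) m := by
  obtain ⟨h1, h2, h3⟩ := lastSets_spec (h + 1) (h + 1) m hm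
  have h4 := card_union_level_sdiff_upShadow h1
  rw [kappa_eq hm]
  omega

theorem admissible_level_lastSets {h k m : ℕ} (hm : m ≤ k)
    (hk : k ≤ (h + 1 + (h + 1)).choose (h + 1))
    (hmk : kappaStar (h + 1 + (h + 1)) (h + 1) k = kappa (h + 1 + (h + 1)) (h + 1) m) :
    Admissible k (level (h + 1 + (h + 1)) (h + 1))
      (lastSets (h + 1 + (h + 1)) (h + 1) m ∪ (level (h + 1 + (h + 1)) (h + 1 + 1) \
        ∂⁺ (lastSets (h + 1 + (h + 1)) (h + 1) m))) := by
  obtain ⟨h1, h2, -⟩ := lastSets_spec (h + 1) (h + 1) m (hm.trans hk)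
  refine ⟨isAntichain_of_sized (sized_level _ _), isAntichain_union_level_sdiff_upShadow h1, ?_, ?_⟩
  · rw [card_level, le_min_iff]
    refine ⟨hk, ?_⟩
    -- The size of the second family is `C(n,h+2) - kappaStar(k)`, at least `C(n,h) - kappa(k)`, and
    -- this is at least `k` because the shadow of the first `k` sets has at most `C(n,h)` members.
    have h3 := card_union_lastSets (hm.trans hk)
    have h4 : kappaStar (h + 1 + (h + 1)) (h + 1) k ≤ _ := kappaStar_le le_rfl
    have h5 := shadowSize_le_choose hk
    rw [kappa_eq hk] at h4
    rw [← hmk, Nat.choose_symm_of_eq_add (show h + 1 + (h + 1) = h + 1 + 1 + h by omega)] at h3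
    omega
  · refine atMostDisjointPairs_of_compl (L := lastSets (h + 1 + (h + 1)) (h + 1) m)
      subset_union_left (fun s hs => ?_) (h2.trans_le hm) fun s hs t ht hst => ?_
    · have := h1 (mem_compls.1 hs)
      rw [card_compl, Fintype.card_fin] at this
      rw [mem_powersetCard_univ]
      omega
    · have hs' := sized_level _ _ hs
      rcases mem_union.1 ht with ht | ht
      · refine ⟨ht, eq_of_subset_of_card_le ?_ ?_⟩
        · exact subset_compl_iff_disjoint_right.2 (disjoint_iff_inter_eq_empty.2 hst)
        · rw [card_compl, Fintype.card_fin, h1 ht, hs']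
          omega
      · refine absurd hst (inter_nonempty_of_card_lt ?_)
        have : #t = h + 1 + 1 := mem_powersetCard_univ.1 (mem_sdiff.1 ht).1
        omega

end DisjointPairs

theorem theorem2p5 (n : ℕ) (hn : 4 ≤ n) (hn2 : Even n) :
    -- the upper bound
    (∀ (k : ℕ) (A B : Finset (Finset (Fin n))), DisjointPairs.Admissible k A B →
      (#A : ℤ) + (#B : ℤ) ≤
        (n.choose (n / 2) : ℤ) + (n.choose (n / 2 + 1) : ℤ)
          - DisjointPairs.kappaStar n (n / 2) k) ∧
    -- the same bound if only the number of disjoint pairs is known to be at most `k`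
    (∀ (k : ℕ) (A B : Finset (Finset (Fin n))),
      IsAntichain (· ⊆ ·) (A : Set (Finset (Fin n))) →
      IsAntichain (· ⊆ ·) (B : Set (Finset (Fin n))) →
      k ≤ min (#A) (#B) →
      #{p ∈ A ×ˢ B | p.1 ∩ p.2 = ∅} ≤ k →
      (#A : ℤ) + (#B : ℤ) ≤
        (n.choose (n / 2) : ℤ) + (n.choose (n / 2 + 1) : ℤ)
          - DisjointPairs.kappaStar n (n / 2) k) ∧
    -- the sign of the correction term
    (∀ k : ℕ, k ≤ n.choose (n / 2) →
      (k < DisjointPairs.threshold (n / 2) → DisjointPairs.kappaStar n (n / 2) k = 0) ∧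
      (DisjointPairs.threshold (n / 2) ≤ k → DisjointPairs.kappaStar n (n / 2) k < 0)) ∧
    -- the first extremal pair
    (∀ k : ℕ, k < DisjointPairs.threshold (n / 2) →
      DisjointPairs.Admissible k
        (DisjointPairs.level n (n / 2)) (DisjointPairs.level n (n / 2 + 1)) ∧
      (#(DisjointPairs.level n (n / 2)) : ℤ) + (#(DisjointPairs.level n (n / 2 + 1)) : ℤ) =
        (n.choose (n / 2) : ℤ) + (n.choose (n / 2 + 1) : ℤ)
          - DisjointPairs.kappaStar n (n / 2) k) ∧
    -- the second extremal pair
    (∀ k : ℕ, DisjointPairs.threshold (n / 2) ≤ k → k ≤ n.choose (n / 2) →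
      (∃ m ≤ k, DisjointPairs.kappaStar n (n / 2) k = DisjointPairs.kappa n (n / 2) m) ∧
      ∀ m ≤ k, DisjointPairs.kappaStar n (n / 2) k = DisjointPairs.kappa n (n / 2) m →
        ∀ B : Finset (Finset (Fin n)),
          B = DisjointPairs.lastSets n (n / 2) m ∪
            (DisjointPairs.level n (n / 2 + 1) \ ∂⁺ (DisjointPairs.lastSets n (n / 2) m)) →
          DisjointPairs.Admissible k (DisjointPairs.level n (n / 2)) B ∧
          (#(DisjointPairs.level n (n / 2)) : ℤ) + (#B : ℤ) =
            (n.choose (n / 2) : ℤ) + (n.choose (n / 2 + 1) : ℤ)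
              - DisjointPairs.kappaStar n (n / 2) k) := by
  obtain ⟨h, rfl⟩ : ∃ h, n = h + 1 + (h + 1) := by
    obtain ⟨r, rfl⟩ := hn2
    exact ⟨r - 1, by omega⟩
  rw [show (h + 1 + (h + 1)) / 2 = h + 1 by omega]
  refine ⟨fun k A B hAB => ?_, fun k A B hA hB _ hk => ?_, fun k _ => ?_, fun k hk => ?_,
    fun k _ hkN => ⟨?_, ?_⟩⟩
  · exact DisjointPairs.card_add_card_le_of_card_inter_compls_le hAB.antichain_left
      hAB.antichain_right
      (DisjointPairs.card_inter_compls_le_of_atMostDisjointPairs hAB.disjoint_pairs)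
  · exact DisjointPairs.card_add_card_le_of_card_inter_compls_le hA hB
      ((DisjointPairs.card_inter_compls_le_card_disjoint A B).trans hk)
  · exact ⟨DisjointPairs.kappaStar_eq_zero, DisjointPairs.kappaStar_neg⟩
  · refine ⟨DisjointPairs.admissible_level_level hk, ?_⟩
    rw [DisjointPairs.kappaStar_eq_zero hk, DisjointPairs.card_level, DisjointPairs.card_level,
      sub_zero]
  · obtain ⟨m, hm, hmk⟩ := exists_mem_eq_inf' (nonempty_range_add_one (n := k))
      (DisjointPairs.kappa (h + 1 + (h + 1)) (h + 1))
    exact ⟨m, Nat.lt_succ_iff.1 (mem_range.1 hm), hmk⟩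
  · rintro m hm hmk B rfl
    refine ⟨DisjointPairs.admissible_level_lastSets hm hkN hmk, ?_⟩
    rw [DisjointPairs.card_union_lastSets (hm.trans hkN), ← hmk, DisjointPairs.card_level]
    ring
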